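/- Let $\rho,\sigma\in\mathbb R$ satisfy $1-\sigma^2>0$ and $1-2\rho^2+\sigma>0$, and let $$\Sigma=\begin{pmatrix}1&\sigma&\rho\\ \sigma&1&\rho\\ \rho&\rho&1\end{pmatrix}.$$ Let $n\ge 1$ be an integer and let $(A_1,B_1,C_1),\dots,(A_n,B_n,C_n)$ be independent random vectors, each with the trivariate normal distribution $N(0,\Sigma)$. Put $X=\sum_{j=1}^n A_jC_j$ and $Y=\sum_{j=1}^n B_jC_j$, and define $$\xi=1-2\rho^2+\sigma,\quad \eta=\frac{1+\sigma}{1-\sigma},\quad \lambda=\frac1{\sqrt{1-\sigma}},\quad \kappa=\frac1{\sqrt{\xi}},\quad \delta=\frac{2\rho}{\xi},\quad \alpha=\frac{\sqrt{2\eta}}{\xi},$$ $$Q=Q(x,y)=\kappa^2(x+y)^2+\lambda^2(x-y)^2,\qquad R=R(x,y)=(1-\rho^2)x^2-2(\sigma-\rho^2)xy+(1-\rho^2)y^2 .$$ Let $K_\nu$ be the modified Bessel function of the second kind, $K_\nu(z)=\int_0^\infty e^{-z\cosh t}\cosh(\nu t)\,dt$ for $z>0$. (a) For all $u,v\in\mathbb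 R$, with the principal branch of the power, $$\mathbb E\,e^{i(uX+vY)}=F_n(u,v)=\left[1+(1-\rho^2)u^2-2i\rho u+(1-\rho^2)v^2-2i\rho v+2(\sigma-\rho^2)uv\right]^{-n/2}.$$ (b) The pair $(X,Y)$ has a joint density with respect to Lebesgue measure on $\mathbb R^2$, namely the nonnegative measurable function given for $(x,y)\ne(0,0)$ by $$f_n(x,y)=\frac{1}{\Gamma(n/2)}\,\frac{\lambda^{n/2}\kappa^{n/2}}{2^{n/2}\,\pi\,\alpha^{(n-2)/2}}\,\exp\!\left(\frac{x+y}{2}\,\delta\right)Q^{(n-2)/4}\,K_{(n-2)/2}\!\left(\frac{\alpha}{2\lambda\kappa}\sqrt{Q}\right).$$ (c) For sample sizes $1,2,3,4$ this formula reduces, for all $(x,y)\neq(0,0)$, to $$f_1(x,y)=\frac1{2\pi}\,\frac{\exp\!\left(\frac1\xi\left(\rho x+\rho y-\sqrt\eta\sqrt R\right)\right)}{\sqrt R},\qquad f_2(x,y)=\frac{\lambda\kappa}{2\pi}\exp\!\left(\frac{x+y}{2}\delta\right)K_0\!\left(\frac{\alpha}{2\lambda\kappa}\sqrt Q\right),$$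 $$f_3(x,y)=\frac1{2\pi\sqrt{1-\sigma^2}}\exp\!\left(\frac1\xi\left(\rho x+\rho y-\sqrt\eta\sqrt R\right)\right),\qquad f_4(x,y)=\frac{\lambda^2\kappa^2}{4\pi\alpha}\exp\!\left(\frac{x+y}{2}\delta\right)\sqrt Q\;K_1\!\left(\frac{\alpha}{2\lambda\kappa}\sqrt Q\right).$$ -/

import Mathlib

open MeasureTheory ProbabilityTheory

noncomputable section

namespace TrivariateNormal

/-- The modified Bessel function of the second kind `K_ν(z)`, for real order `ν` and `z > 0`,
by its standard integral representation `K_ν(z) = ∫_0^∞ exp(-z cosh t) cosh(ν t) dt`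
(the integral converges absolutely for every `z > 0`). -/
def besselK (ν z : ℝ) : ℝ :=
  ∫ t in Set.Ioi (0 : ℝ), Real.exp (-z * Real.cosh t) * Real.cosh (ν * t)

/-- The covariance matrix of `(A, B, C)`: unit variances, `Cov(A,B) = σ`,
`Cov(A,C) = Cov(B,C) = ρ`. -/
def covMat (ρ σ : ℝ) : Matrix (Fin 3) (Fin 3) ℝ :=
  !![1, σ, ρ;
     σ, 1, ρ;
     ρ, ρ, 1]

/-- `ξ = 1 - 2ρ² + σ`. -/
def xi (ρ σ : ℝ) : ℝ := 1 - 2 * ρ ^ 2 + σ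

/-- `η = (1 + σ) / (1 - σ)`. -/
def eta (σ : ℝ) : ℝ := (1 + σ) / (1 - σ)

/-- `λ = 1 / √(1 - σ)`. -/
def lam (σ : ℝ) : ℝ := 1 / Real.sqrt (1 - σ)

/-- `κ = 1 / √(1 - 2ρ² + σ)`. -/
def kap (ρ σ : ℝ) : ℝ := 1 / Real.sqrt (1 - 2 * ρ ^ 2 + σ)

/-- `δ = 2ρ / ξ`. -/
def del (ρ σ : ℝ) : ℝ := 2 * ρ / xi ρ σ

/-- `α = √(2η) / ξ`. -/
def alp (ρ σ : ℝ) : ℝ := Real.sqrt (2 * eta σ) / xi ρ σ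

/-- `Q(x, y) = κ² (x + y)² + λ² (x - y)²`. -/
def Q (ρ σ x y : ℝ) : ℝ := kap ρ σ ^ 2 * (x + y) ^ 2 + lam σ ^ 2 * (x - y) ^ 2

/-- `R(x, y) = (1 - ρ²) x² - 2 (σ - ρ²) x y + (1 - ρ²) y²`. -/
def R (ρ σ x y : ℝ) : ℝ :=
  (1 - ρ ^ 2) * x ^ 2 - 2 * (σ - ρ ^ 2) * x * y + (1 - ρ ^ 2) * y ^ 2

/-- The characteristic function
`F_n(u,v) = [1 + (1-ρ²)u² - 2iρu + (1-ρ²)v² - 2iρv + 2(σ-ρ²)uv]^(-n/2)`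
(principal branch of the power; the base has real part at least `1`). -/
def charFn (ρ σ : ℝ) (n : ℕ) (u v : ℝ) : ℂ :=
  (1 + (1 - (ρ : ℂ) ^ 2) * (u : ℂ) ^ 2 - 2 * Complex.I * (ρ : ℂ) * (u : ℂ)
    + (1 - (ρ : ℂ) ^ 2) * (v : ℂ) ^ 2 - 2 * Complex.I * (ρ : ℂ) * (v : ℂ)
    + 2 * ((σ : ℂ) - (ρ : ℂ) ^ 2) * (u : ℂ) * (v : ℂ)) ^ (-((n : ℂ) / 2))

/-- The joint density `f_n(x, y)`. -/
def jointDensity (ρ σ : ℝ) (n : ℕ) (x y : ℝ) : ℝ :=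
  (1 / Real.Gamma ((n : ℝ) / 2)) *
    ((lam σ ^ ((n : ℝ) / 2) * kap ρ σ ^ ((n : ℝ) / 2)) /
      ((2 : ℝ) ^ ((n : ℝ) / 2) * Real.pi * alp ρ σ ^ (((n : ℝ) - 2) / 2))) *
    Real.exp ((x + y) / 2 * del ρ σ) *
    Q ρ σ x y ^ (((n : ℝ) - 2) / 4) *
    besselK (((n : ℝ) - 2) / 2)
      (alp ρ σ / (2 * lam σ * kap ρ σ) * Real.sqrt (Q ρ σ x y))

end TrivariateNormal

end

/-!
Conditionally on `w = ∑ C j ^ 2`, the variables `X + Y` and `X - Y` are independent normal with laws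
`N(2 ρ w, 2 ξ w)` and `N(0, 2 (1 - σ) w)`, and `w` has the gamma law of shape `n / 2` and rate `1 / 2`.
The density of `(X, Y)` should therefore be the mixture of the conditional densities `condDensity`
over that gamma law. The mixture is evaluated by
`∫ w ^ (ν - 1) * exp (-a w - b / w) = 2 (b / a) ^ (ν / 2) K_ν(2 √(a b))`
(`integral_rpow_mul_exp_neg_mul_sub_div`), with `a = (1 + σ) / (2 ξ)`, `b = Q / 4` and
`ν = (n - 2) / 2`, and the result is `jointDensity` (`jointDensity_eq_integral`).

To prove that this is the density, no conditioning is carried out; two characteristic functions are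
compared instead.

* For the sums, independence reduces the characteristic function to one vector `(A, B, C)`. There the
  residual `u A + v B - ρ (u + v) C` is independent of `C` (`map_residual_multivariateGaussian`), and a
  complex Gaussian integral gives `charFn ρ σ 1 u v`; its `n`-th power is `charFn ρ σ n u v`.
* For the density, Fubini's theorem leaves the Gaussian characteristic function of `condDensity`, which
  is exponential in `w`, to be integrated against the gamma law. The complex Laplace transform of the
  gamma law (`complexMGF_gammaMeasure`) gives `charFn ρ σ n u v` again
  (`integral_jointDensity_mul_cexp`).

For sample sizes `1` and `3` the Bessel functions `K_{-1/2} = K_{1/2}` are elementary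
(`besselK_one_half`).
-/

namespace TrivariateNormal

/-! ### The modified Bessel function of the second kind -/

theorem besselK_neg (ν z : ℝ) : besselK (-ν) z = besselK ν z := by
  simp [besselK]

theorem besselK_nonneg (ν z : ℝ) : 0 ≤ besselK ν z :=
  integral_nonneg fun _ => mul_nonneg (Real.exp_pos _).le (Real.cosh_pos _).le

theorem measurable_besselK (ν : ℝ) : Measurable (besselK ν) := by
  have h : StronglyMeasurable (fun p : ℝ × ℝ =>
      Real.exp (-p.1 * Real.cosh p.2) * Real.cosh (ν * p.2)) := by
    apply Continuous.stronglyMeasurable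
    fun_prop
  exact (h.integral_prod_right (ν := volume.restrict (Set.Ioi (0 : ℝ)))).measurable

/-- The substitution `s = sinh (t / 2)`, for which `cosh t = 1 + 2 * s ^ 2`, reduces the integral
to a Gaussian one. -/
theorem besselK_one_half (z : ℝ) :
    besselK (1 / 2) z = Real.sqrt (Real.pi / (2 * z)) * Real.exp (-z) := by
  have himg : (fun t => Real.sinh (t / 2)) '' Set.Ioi (0 : ℝ) = Set.Ioi 0 := by
    ext s
    simp only [Set.mem_image, Set.mem_Ioi]
    constructor
    · rintro ⟨t, ht, rfl⟩
      exact Real.sinh_pos_iff.2 (by linarith)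
    · intro hs
      refine ⟨2 * Real.arsinh s, by have := Real.arsinh_pos_iff.2 hs; linarith, ?_⟩
      simp
  have hder : ∀ t ∈ Set.Ioi (0 : ℝ), HasDerivWithinAt (fun t => Real.sinh (t / 2))
      (Real.cosh (t / 2) * (1 / 2)) (Set.Ioi 0) t := fun t _ =>
    ((hasDerivAt_id' t).div_const 2).sinh.hasDerivWithinAt
  have hinj : Set.InjOn (fun t => Real.sinh (t / 2)) (Set.Ioi (0 : ℝ)) := by
    intro s _ t _ h
    have := Real.sinh_injective h
    linarith
  have key := integral_image_eq_integral_abs_deriv_smul measurableSet_Ioi hder hinj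
    (fun s => Real.exp (-(2 * z) * s ^ 2))
  rw [himg, integral_gaussian_Ioi] at key
  have : besselK (1 / 2) z = 2 * Real.exp (-z) * ∫ t in Set.Ioi (0 : ℝ),
      |Real.cosh (t / 2) * (1 / 2)| • Real.exp (-(2 * z) * Real.sinh (t / 2) ^ 2) := by
    rw [besselK, ← integral_const_mul]
    refine integral_congr_ae (Filter.Eventually.of_forall fun t => ?_)
    have hc := Real.cosh_pos (t / 2)
    have h2 : Real.cosh t = 1 + 2 * Real.sinh (t / 2) ^ 2 := by
      have h := Real.cosh_two_mul (t / 2)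
      rw [Real.cosh_sq, mul_div_cancel₀ _ (two_ne_zero)] at h
      linarith
    have h3 : Real.exp (-z * Real.cosh t)
        = Real.exp (-z) * Real.exp (-(2 * z) * Real.sinh (t / 2) ^ 2) := by
      rw [h2, ← Real.exp_add]; ring_nf
    simp only
    rw [abs_of_pos (by positivity), h3, smul_eq_mul, show 1 / 2 * t = t / 2 by ring]
    ring
  rw [this, ← key]
  ring

/-- The factor `exp (-b / w)` vanishes at `0` faster than any power, which restores integrability
at the origin for arbitrary real exponents. -/
theorem integrableOn_rpow_mul_exp_neg_mul_sub_div (ν : ℝ) {a b : ℝ} (ha : 0 < a) (hb : 0 < b) :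
    IntegrableOn (fun w : ℝ => w ^ (ν - 1) * Real.exp (-(a * w) - b / w)) (Set.Ioi 0) := by
  -- `exp (-b / w) ≤ k! (w / b) ^ k` raises the exponent of `w` to `ν + k - 1 > -1`
  obtain ⟨k, hk⟩ := exists_nat_gt (-ν)
  have hdom : IntegrableOn (fun w : ℝ => (k.factorial / b ^ k) *
      (w ^ (ν + k - 1) * Real.exp (-(a * w)))) (Set.Ioi 0) := by
    have h := integrableOn_rpow_mul_exp_neg_mul_rpow (s := ν + k - 1) (p := 1) (b := a)
      (by linarith) (by norm_num) ha
    simp only [Real.rpow_one, neg_mul] at h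
    exact Integrable.const_mul h _
  refine hdom.mono' ?_ ?_
  · refine Measurable.aestronglyMeasurable ?_
    fun_prop
  · refine (ae_restrict_iff' measurableSet_Ioi).2 (Filter.Eventually.of_forall fun w hw => ?_)
    have hw : 0 < w := hw
    have h1 : Real.exp (-(b / w)) ≤ k.factorial / b ^ k * w ^ k := by
      have h := Real.pow_div_factorial_le_exp (b / w) (by positivity) k
      rw [Real.exp_neg, show (k.factorial : ℝ) / b ^ k * w ^ k = ((b / w) ^ k / k.factorial)⁻¹ by
        rw [div_pow]; field_simp]
      gcongr
    rw [Real.norm_of_nonneg (by positivity), sub_eq_add_neg (-(a * w)), Real.exp_add,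
      show ν + k - 1 = (ν - 1) + k by ring, Real.rpow_add hw, Real.rpow_natCast]
    calc w ^ (ν - 1) * (Real.exp (-(a * w)) * Real.exp (-(b / w)))
        ≤ w ^ (ν - 1) * (Real.exp (-(a * w)) * (k.factorial / b ^ k * w ^ k)) := by gcongr
      _ = _ := by ring

/-- The substitution `w = √(b / a) * exp t` symmetrises the exponent `a * w + b / w` to
`2 * √(a * b) * cosh t`. -/
theorem integral_rpow_mul_exp_neg_mul_sub_div (ν : ℝ) {a b : ℝ} (ha : 0 < a) (hb : 0 < b) :
    ∫ w in Set.Ioi (0 : ℝ), w ^ (ν - 1) * Real.exp (-(a * w) - b / w)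
      = 2 * (b / a) ^ (ν / 2) * besselK ν (2 * Real.sqrt (a * b)) := by
  set c := Real.sqrt (b / a) with hc
  have hc0 : 0 < c := Real.sqrt_pos.2 (by positivity)
  set z := 2 * Real.sqrt (a * b) with hz
  have hac : a * c = Real.sqrt (a * b) := by
    rw [hc, ← Real.sqrt_sq ha.le, ← Real.sqrt_mul (sq_nonneg a), Real.sqrt_sq ha.le]
    congr 1; field_simp
  have hbc : b / c = Real.sqrt (a * b) := by
    rw [← hac, div_eq_iff hc0.ne', mul_assoc, hc, Real.mul_self_sqrt (by positivity)]
    field_simp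
  have himg : (fun t => c * Real.exp t) '' Set.univ = Set.Ioi (0 : ℝ) := by
    ext s
    simp only [Set.image_univ, Set.mem_range, Set.mem_Ioi]
    constructor
    · rintro ⟨t, rfl⟩; positivity
    · intro hs
      refine ⟨Real.log (s / c), ?_⟩
      rw [Real.exp_log (by positivity)]; field_simp
  have hder : ∀ t ∈ Set.univ, HasDerivWithinAt (fun t => c * Real.exp t)
      (c * Real.exp t) Set.univ t := fun t _ =>
    ((Real.hasDerivAt_exp t).const_mul c).hasDerivWithinAt
  have hinj : Set.InjOn (fun t => c * Real.exp t) Set.univ := by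
    intro s _ t _ h
    exact Real.exp_injective (mul_left_cancel₀ hc0.ne' h)
  have hfun : ∀ t : ℝ, |c * Real.exp t| • ((c * Real.exp t) ^ (ν - 1)
      * Real.exp (-(a * (c * Real.exp t)) - b / (c * Real.exp t)))
      = c ^ ν * (Real.exp (ν * t) * Real.exp (-z * Real.cosh t)) := by
    intro t
    have hp : 0 < c * Real.exp t := by positivity
    have h1 : c * Real.exp t * (c * Real.exp t) ^ (ν - 1) = c ^ ν * Real.exp (ν * t) := by
      conv_lhs => rw [← Real.rpow_one (c * Real.exp t), Real.rpow_one, mul_comm,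
        ← Real.rpow_add_one hp.ne']
      rw [sub_add_cancel, Real.mul_rpow hc0.le (Real.exp_pos t).le, ← Real.exp_mul, mul_comm t]
    have h2 : -(a * (c * Real.exp t)) - b / (c * Real.exp t) = -z * Real.cosh t := by
      rw [← mul_assoc, hac, ← div_div, hbc, hz, Real.cosh_eq, Real.exp_neg]
      ring
    rw [abs_of_pos hp, smul_eq_mul, ← mul_assoc, h1, h2, mul_assoc]
  have key := integral_image_eq_integral_abs_deriv_smul MeasurableSet.univ hder hinj
    (fun w => w ^ (ν - 1) * Real.exp (-(a * w) - b / w))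
  have keyint := (integrableOn_image_iff_integrableOn_abs_deriv_smul MeasurableSet.univ hder hinj
    (fun w => w ^ (ν - 1) * Real.exp (-(a * w) - b / w))).1
    (himg ▸ integrableOn_rpow_mul_exp_neg_mul_sub_div ν ha hb)
  simp only [hfun] at key keyint
  rw [himg, integral_const_mul] at key
  rw [key]
  have hcν : c ^ ν = (b / a) ^ (ν / 2) := by
    rw [hc, Real.sqrt_eq_rpow, ← Real.rpow_mul (by positivity)]
    congr 1; ring
  rw [integrableOn_univ] at keyint
  have hI : Integrable (fun t : ℝ => Real.exp (ν * t) * Real.exp (-z * Real.cosh t)) := by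
    refine (integrable_const_mul_iff ?_ _).1 keyint
    exact (Real.rpow_pos_of_pos hc0 ν).ne'.isUnit
  -- averaging over `t` and `-t` replaces `exp (ν t)` by `cosh (ν t)`
  have hsym : ∫ t : ℝ, Real.exp (ν * t) * Real.exp (-z * Real.cosh t) = 2 * besselK ν z := by
    have h1 := integral_neg_eq_self (fun t : ℝ => Real.exp (ν * t) * Real.exp (-z * Real.cosh t))
      volume
    have h2 := integral_add hI hI.comp_neg
    have h3 := integral_comp_abs (f := fun t : ℝ => Real.exp (-z * Real.cosh t) * Real.cosh (ν * t))
    have h4 : (∫ t : ℝ, (Real.exp (ν * t) * Real.exp (-z * Real.cosh t)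
        + Real.exp (ν * -t) * Real.exp (-z * Real.cosh (-t))))
        = ∫ t : ℝ, 2 * (Real.exp (-z * Real.cosh |t|) * Real.cosh (ν * |t|)) := by
      congr 1; ext t
      have : Real.cosh (ν * |t|) = Real.cosh (ν * t) := by
        rcases abs_choice t with h | h <;> simp [h]
      rw [this, Real.cosh_abs, Real.cosh_neg, Real.cosh_eq (ν * t)]
      ring_nf
    rw [h4, integral_const_mul, h3, h1] at h2
    rw [besselK]
    linarith
  rw [MeasureTheory.setIntegral_univ, hsym, hcν]
  ring

/-! ### The parameters and the density -/

variable {ρ σ : ℝ}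

theorem xi_pos (hρσ : 0 < 1 - 2 * ρ ^ 2 + σ) : 0 < xi ρ σ := hρσ

theorem one_sub_sigma_pos (hσ : 0 < 1 - σ ^ 2) : 0 < 1 - σ := by nlinarith

theorem one_add_sigma_pos (hσ : 0 < 1 - σ ^ 2) : 0 < 1 + σ := by nlinarith

theorem lam_pos (hσ : 0 < 1 - σ ^ 2) : 0 < lam σ :=
  one_div_pos.2 (Real.sqrt_pos.2 (one_sub_sigma_pos hσ))

theorem kap_pos (hρσ : 0 < 1 - 2 * ρ ^ 2 + σ) : 0 < kap ρ σ :=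
  one_div_pos.2 (Real.sqrt_pos.2 hρσ)

theorem lam_sq (hσ : 0 < 1 - σ ^ 2) : lam σ ^ 2 = 1 / (1 - σ) := by
  rw [lam, div_pow, Real.sq_sqrt (one_sub_sigma_pos hσ).le, one_pow]

theorem kap_sq (hρσ : 0 < 1 - 2 * ρ ^ 2 + σ) : kap ρ σ ^ 2 = 1 / xi ρ σ := by
  rw [kap, div_pow, Real.sq_sqrt hρσ.le, one_pow, xi]

theorem eta_pos (hσ : 0 < 1 - σ ^ 2) : 0 < eta σ :=
  div_pos (one_add_sigma_pos hσ) (one_sub_sigma_pos hσ)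

theorem alp_pos (hσ : 0 < 1 - σ ^ 2) (hρσ : 0 < 1 - 2 * ρ ^ 2 + σ) : 0 < alp ρ σ :=
  div_pos (Real.sqrt_pos.2 (mul_pos two_pos (eta_pos hσ))) (xi_pos hρσ)

theorem alp_sq (hσ : 0 < 1 - σ ^ 2) : alp ρ σ ^ 2 = 2 * eta σ / xi ρ σ ^ 2 := by
  rw [alp, div_pow, Real.sq_sqrt (mul_pos two_pos (eta_pos hσ)).le]

theorem alp_div_lam_mul_kap_sq (hσ : 0 < 1 - σ ^ 2) (hρσ : 0 < 1 - 2 * ρ ^ 2 + σ) :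
    (alp ρ σ / (lam σ * kap ρ σ)) ^ 2 = 2 * (1 + σ) / xi ρ σ := by
  have := xi_pos hρσ
  have := one_sub_sigma_pos hσ
  rw [div_pow, mul_pow, alp_sq hσ, lam_sq hσ, kap_sq hρσ, eta]
  field_simp

theorem Q_eq (hσ : 0 < 1 - σ ^ 2) (hρσ : 0 < 1 - 2 * ρ ^ 2 + σ) (x y : ℝ) :
    Q ρ σ x y = 2 * (lam σ * kap ρ σ) ^ 2 * R ρ σ x y := by
  have h1 := xi_pos hρσ
  have := one_sub_sigma_pos hσ
  rw [Q, mul_pow, lam_sq hσ, kap_sq hρσ, R]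
  field_simp
  rw [xi]
  ring

theorem Q_nonneg (x y : ℝ) : 0 ≤ Q ρ σ x y := by
  unfold Q; positivity

theorem Q_pos (hσ : 0 < 1 - σ ^ 2) (hρσ : 0 < 1 - 2 * ρ ^ 2 + σ) {x y : ℝ}
    (h : (x, y) ≠ (0, 0)) : 0 < Q ρ σ x y := by
  have hl := lam_pos hσ
  have hk := kap_pos hρσ
  refine lt_of_le_of_ne (Q_nonneg x y) fun h0 => h ?_
  rw [Q, eq_comm, add_eq_zero_iff_of_nonneg (by positivity) (by positivity)] at h0
  have h1 : x + y = 0 := by simpa [hk.ne'] using h0.1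
  have h2 : x - y = 0 := by simpa [hl.ne'] using h0.2
  exact Prod.ext (by simp only; linarith) (by simp only; linarith)

/-- The density in terms of the two combinations `lam * kap * √Q / alp` and
`alp * √Q / (2 * lam * kap)`, with the fractional powers collected into one. At the
origin both sides contain the same divergent Bessel integral, so the identity needs no hypothesis
on `(x, y)`. -/
theorem jointDensity_eq (hσ : 0 < 1 - σ ^ 2) (hρσ : 0 < 1 - 2 * ρ ^ 2 + σ) (n : ℕ) (x y : ℝ) :
    jointDensity ρ σ n x y = 1 / Real.Gamma (n / 2) *
      (lam σ * kap ρ σ / ((2 : ℝ) ^ ((n : ℝ) / 2) * Real.pi)) *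
      Real.exp ((x + y) / 2 * del ρ σ) *
      ((lam σ * kap ρ σ * √(Q ρ σ x y) / alp ρ σ) ^ (((n : ℝ) - 2) / 2) *
      besselK (((n : ℝ) - 2) / 2) (alp ρ σ * √(Q ρ σ x y) / (2 * (lam σ * kap ρ σ)))) := by
  have hl := lam_pos hσ
  have hk := kap_pos hρσ
  have ha := alp_pos hσ hρσ
  have h1 : lam σ ^ ((n : ℝ) / 2) * kap ρ σ ^ ((n : ℝ) / 2)
      = lam σ * kap ρ σ * (lam σ * kap ρ σ) ^ (((n : ℝ) - 2) / 2) := by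
    rw [← Real.mul_rpow hl.le hk.le, mul_comm (lam σ * kap ρ σ) (_ ^ _),
      ← Real.rpow_add_one (by positivity)]
    congr 1; ring
  have h2 : Q ρ σ x y ^ (((n : ℝ) - 2) / 4) = √(Q ρ σ x y) ^ (((n : ℝ) - 2) / 2) := by
    rw [Real.sqrt_eq_rpow, ← Real.rpow_mul (Q_nonneg x y)]
    congr 1; ring
  have h3 : alp ρ σ / (2 * lam σ * kap ρ σ) * √(Q ρ σ x y)
      = alp ρ σ * √(Q ρ σ x y) / (2 * (lam σ * kap ρ σ)) := by
    rw [← mul_assoc]; ring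
  rw [jointDensity, h1, h2, h3, Real.div_rpow (by positivity) ha.le,
    Real.mul_rpow (y := √(Q ρ σ x y)) (by positivity) (by positivity)]
  ring

theorem jointDensity_nonneg (hσ : 0 < 1 - σ ^ 2) (hρσ : 0 < 1 - 2 * ρ ^ 2 + σ) (n : ℕ)
    (x y : ℝ) : 0 ≤ jointDensity ρ σ n x y := by
  have hl := lam_pos hσ
  have hk := kap_pos hρσ
  have ha := alp_pos hσ hρσ
  have := Real.Gamma_nonneg_of_nonneg (show (0 : ℝ) ≤ n / 2 by positivity)
  have := besselK_nonneg (((n : ℝ) - 2) / 2) (alp ρ σ * √(Q ρ σ x y) / (2 * (lam σ * kap ρ σ)))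
  rw [jointDensity_eq hσ hρσ]
  positivity

theorem measurable_jointDensity (ρ σ : ℝ) (n : ℕ) :
    Measurable (fun p : ℝ × ℝ => jointDensity ρ σ n p.1 p.2) := by
  have hQ : Measurable (fun p : ℝ × ℝ => Q ρ σ p.1 p.2) := by
    unfold Q; fun_prop
  have hK := (measurable_besselK (((n : ℝ) - 2) / 2)).comp
    (hQ.sqrt.const_mul (alp ρ σ / (2 * lam σ * kap ρ σ)))
  unfold jointDensity
  exact (((by fun_prop : Measurable (fun p : ℝ × ℝ => 1 / Real.Gamma ((n : ℝ) / 2) *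
    ((lam σ ^ ((n : ℝ) / 2) * kap ρ σ ^ ((n : ℝ) / 2)) /
      ((2 : ℝ) ^ ((n : ℝ) / 2) * Real.pi * alp ρ σ ^ (((n : ℝ) - 2) / 2))) *
    Real.exp ((p.1 + p.2) / 2 * del ρ σ))).mul (hQ.pow_const _)).mul hK)

theorem sqrt_Q (hσ : 0 < 1 - σ ^ 2) (hρσ : 0 < 1 - 2 * ρ ^ 2 + σ) (x y : ℝ) :
    √(Q ρ σ x y) = √2 * (lam σ * kap ρ σ) * √(R ρ σ x y) := by
  have hl := lam_pos hσ
  have hk := kap_pos hρσ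
  rw [Q_eq hσ hρσ, Real.sqrt_mul (by positivity), Real.sqrt_mul zero_le_two,
    Real.sqrt_sq (by positivity)]

/-- The common exponential factor of the densities for sample sizes `1` and `3`, where the Bessel
function is elementary. -/
theorem exp_mul_exp_neg_eq (hσ : 0 < 1 - σ ^ 2) (hρσ : 0 < 1 - 2 * ρ ^ 2 + σ) (x y : ℝ) :
    Real.exp ((x + y) / 2 * del ρ σ) *
      Real.exp (-(alp ρ σ * √(Q ρ σ x y) / (2 * (lam σ * kap ρ σ))))
    = Real.exp (1 / xi ρ σ * (ρ * x + ρ * y - √(eta σ) * √(R ρ σ x y))) := by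
  have hl := lam_pos hσ
  have hk := kap_pos hρσ
  have := xi_pos hρσ
  rw [← Real.exp_add, sqrt_Q hσ hρσ, alp, Real.sqrt_mul zero_le_two, del]
  congr 1
  field_simp
  rw [Real.sq_sqrt zero_le_two]
  ring

/-! ### Small sample sizes -/

theorem jointDensity_one (hσ : 0 < 1 - σ ^ 2) (hρσ : 0 < 1 - 2 * ρ ^ 2 + σ) {x y : ℝ}
    (h : (x, y) ≠ (0, 0)) :
    jointDensity ρ σ 1 x y = 1 / (2 * Real.pi) *
      (Real.exp (1 / xi ρ σ * (ρ * x + ρ * y - √(eta σ) * √(R ρ σ x y))) / √(R ρ σ x y)) := by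
  have hl := lam_pos hσ
  have hk := kap_pos hρσ
  have ha := alp_pos hσ hρσ
  have hQ := Real.sqrt_pos.2 (Q_pos hσ hρσ h)
  have hR : 0 < √(R ρ σ x y) := by
    rw [sqrt_Q hσ hρσ] at hQ
    exact pos_of_mul_pos_right hQ (by positivity)
  rw [jointDensity_eq hσ hρσ, ← exp_mul_exp_neg_eq hσ hρσ]
  have e1 : (((1 : ℕ) : ℝ) - 2) / 2 = -(1 / 2) := by norm_num
  have hprod : (lam σ * kap ρ σ * √(Q ρ σ x y) / alp ρ σ) ^ (-(1 / 2) : ℝ) *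
      √(Real.pi / (2 * (alp ρ σ * √(Q ρ σ x y) / (2 * (lam σ * kap ρ σ)))))
      = √Real.pi / √(Q ρ σ x y) := by
    rw [Real.rpow_neg (by positivity), ← Real.sqrt_eq_rpow, ← Real.sqrt_inv, ← Real.sqrt_mul
      (by positivity), ← Real.sqrt_sq hQ.le, ← Real.sqrt_div Real.pi_pos.le, Real.sqrt_sq hQ.le]
    congr 1
    field_simp
  rw [e1, besselK_neg, besselK_one_half, ← mul_assoc (_ ^ _), hprod, Nat.cast_one,
    Real.Gamma_one_half_eq, ← Real.sqrt_eq_rpow, sqrt_Q hσ hρσ]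
  have h2 : √(2 : ℝ) ^ 2 = 2 := Real.sq_sqrt zero_le_two
  field_simp
  rw [h2]

theorem jointDensity_three (hσ : 0 < 1 - σ ^ 2) (hρσ : 0 < 1 - 2 * ρ ^ 2 + σ) {x y : ℝ}
    (h : (x, y) ≠ (0, 0)) :
    jointDensity ρ σ 3 x y = 1 / (2 * Real.pi * √(1 - σ ^ 2)) *
      Real.exp (1 / xi ρ σ * (ρ * x + ρ * y - √(eta σ) * √(R ρ σ x y))) := by
  have hl := lam_pos hσ
  have hk := kap_pos hρσ
  have ha := alp_pos hσ hρσ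
  have hQ := Real.sqrt_pos.2 (Q_pos hσ hρσ h)
  rw [jointDensity_eq hσ hρσ, ← exp_mul_exp_neg_eq hσ hρσ]
  have e1 : (((3 : ℕ) : ℝ) - 2) / 2 = 1 / 2 := by norm_num
  have hprod : (lam σ * kap ρ σ * √(Q ρ σ x y) / alp ρ σ) ^ (1 / 2 : ℝ) *
      √(Real.pi / (2 * (alp ρ σ * √(Q ρ σ x y) / (2 * (lam σ * kap ρ σ)))))
      = √Real.pi * (lam σ * kap ρ σ) / alp ρ σ := by
    rw [← Real.sqrt_eq_rpow, ← Real.sqrt_mul (by positivity),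
      show lam σ * kap ρ σ * √(Q ρ σ x y) / alp ρ σ *
          (Real.pi / (2 * (alp ρ σ * √(Q ρ σ x y) / (2 * (lam σ * kap ρ σ)))))
        = Real.pi * (lam σ * kap ρ σ / alp ρ σ) ^ 2 by field_simp,
      Real.sqrt_mul Real.pi_pos.le, Real.sqrt_sq (by positivity), ← mul_div_assoc]
  have e2 : (2 : ℝ) ^ (((3 : ℕ) : ℝ) / 2) = 2 * √2 := by
    rw [show (((3 : ℕ) : ℝ) / 2) = 1 + 1 / 2 by norm_num, Real.rpow_add two_pos, Real.rpow_one,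
      Real.sqrt_eq_rpow]
  have e3 : Real.Gamma (((3 : ℕ) : ℝ) / 2) = √Real.pi / 2 := by
    rw [show (((3 : ℕ) : ℝ) / 2) = 1 / 2 + 1 by norm_num, Real.Gamma_add_one (by norm_num),
      Real.Gamma_one_half_eq]
    ring
  have e4 : (lam σ * kap ρ σ) ^ 2 * √(1 - σ ^ 2) = alp ρ σ / √2 := by
    have h1 := one_sub_sigma_pos hσ
    have h2 := one_add_sigma_pos hσ
    have := xi_pos hρσ
    rw [mul_pow, lam_sq hσ, kap_sq hρσ, alp, Real.sqrt_mul zero_le_two, eta,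
      Real.sqrt_div h2.le, show 1 - σ ^ 2 = (1 + σ) * (1 - σ) by ring, Real.sqrt_mul h2.le]
    have h3 : √(1 - σ) ≠ 0 := (Real.sqrt_pos.2 h1).ne'
    field_simp
    rw [Real.sq_sqrt h1.le]
  have h4 : 0 < √(1 - σ ^ 2) := Real.sqrt_pos.2 hσ
  have e5 : alp ρ σ = (lam σ * kap ρ σ) ^ 2 * √(1 - σ ^ 2) * √2 := by
    rw [e4]; field_simp
  rw [e1, besselK_one_half, ← mul_assoc (_ ^ _), hprod, e2, e3]
  generalize Real.exp (-_) = E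
  rw [e5]
  have h2 : √(2 : ℝ) ^ 2 = 2 := Real.sq_sqrt zero_le_two
  field_simp
  rw [h2]

theorem jointDensity_two (hσ : 0 < 1 - σ ^ 2) (hρσ : 0 < 1 - 2 * ρ ^ 2 + σ) (x y : ℝ) :
    jointDensity ρ σ 2 x y = lam σ * kap ρ σ / (2 * Real.pi) *
      Real.exp ((x + y) / 2 * del ρ σ) *
      besselK 0 (alp ρ σ / (2 * lam σ * kap ρ σ) * √(Q ρ σ x y)) := by
  rw [jointDensity_eq hσ hρσ]
  have e1 : (((2 : ℕ) : ℝ) - 2) / 2 = 0 := by norm_num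
  have e2 : (((2 : ℕ) : ℝ)) / 2 = 1 := by norm_num
  rw [e1, e2, Real.rpow_zero, Real.Gamma_one, Real.rpow_one,
    show alp ρ σ * √(Q ρ σ x y) / (2 * (lam σ * kap ρ σ))
      = alp ρ σ / (2 * lam σ * kap ρ σ) * √(Q ρ σ x y) by rw [← mul_assoc]; ring]
  ring

theorem jointDensity_four (hσ : 0 < 1 - σ ^ 2) (hρσ : 0 < 1 - 2 * ρ ^ 2 + σ) (x y : ℝ) :
    jointDensity ρ σ 4 x y = lam σ ^ 2 * kap ρ σ ^ 2 / (4 * Real.pi * alp ρ σ) *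
      Real.exp ((x + y) / 2 * del ρ σ) * √(Q ρ σ x y) *
      besselK 1 (alp ρ σ / (2 * lam σ * kap ρ σ) * √(Q ρ σ x y)) := by
  have ha := alp_pos hσ hρσ
  rw [jointDensity_eq hσ hρσ]
  have e1 : (((4 : ℕ) : ℝ) - 2) / 2 = 1 := by norm_num
  have e2 : (((4 : ℕ) : ℝ)) / 2 = 2 := by norm_num
  rw [e1, e2, Real.rpow_one, Real.Gamma_two, show (2 : ℝ) ^ (2 : ℝ) = 4 by norm_num,
    show alp ρ σ * √(Q ρ σ x y) / (2 * (lam σ * kap ρ σ))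
      = alp ρ σ / (2 * lam σ * kap ρ σ) * √(Q ρ σ x y) by rw [← mul_assoc]; ring]
  ring

/-! ### The density as a gamma mixture of Gaussian densities -/

/-- The Gaussian density of `(X, Y)` when the sum of squares `∑ C j ^ 2` has the value `w`: then
`X + Y` and `X - Y` are independent normal variables with laws `N(2 ρ w, 2 ξ w)` and
`N(0, 2 (1 - σ) w)`, and the leading `2` is the Jacobian of `(x, y) ↦ (x + y, x - y)`. -/
noncomputable def condDensity (ρ σ w x y : ℝ) : ℝ :=
  2 * gaussianPDFReal (2 * ρ * w) (2 * xi ρ σ * w).toNNReal (x + y) *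
    gaussianPDFReal 0 (2 * (1 - σ) * w).toNNReal (x - y)

theorem condDensity_nonneg (ρ σ w x y : ℝ) : 0 ≤ condDensity ρ σ w x y :=
  mul_nonneg (mul_nonneg zero_le_two (gaussianPDFReal_nonneg _ _ _)) (gaussianPDFReal_nonneg _ _ _)

theorem measurable_condDensity (ρ σ : ℝ) :
    Measurable (fun p : ℝ × ℝ × ℝ => condDensity ρ σ p.1 p.2.1 p.2.2) := by
  unfold condDensity gaussianPDFReal
  fun_prop

/-- As a function of `w`, the joint density of the sum of squares and `(X, Y)` is a power of `w`
times `exp (-a w - b / w)` with `a = (1 + σ) / (2 ξ)` and `b = Q / 4`. -/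
theorem gammaPDFReal_mul_condDensity (hσ : 0 < 1 - σ ^ 2) (hρσ : 0 < 1 - 2 * ρ ^ 2 + σ) (n : ℕ)
    {w : ℝ} (hw : 0 < w) (x y : ℝ) :
    gammaPDFReal (n / 2) (1 / 2) w * condDensity ρ σ w x y =
      1 / Real.Gamma (n / 2) * (lam σ * kap ρ σ / ((2 : ℝ) ^ ((n : ℝ) / 2) * (2 * Real.pi))) *
        Real.exp ((x + y) / 2 * del ρ σ) *
        (w ^ (((n : ℝ) - 2) / 2 - 1) *
          Real.exp (-((1 + σ) / (2 * xi ρ σ) * w) - Q ρ σ x y / 4 / w)) := by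
  have hξ := xi_pos hρσ
  have hs := one_sub_sigma_pos hσ
  have hs1 : √(2 * Real.pi * (2 * xi ρ σ * w)) * √(2 * Real.pi * (2 * (1 - σ) * w))
      = 4 * Real.pi * w / (lam σ * kap ρ σ) := by
    rw [← Real.sqrt_mul (by positivity)]
    have h4 : 0 ≤ 4 * Real.pi * w / (lam σ * kap ρ σ) := by
      have := lam_pos hσ
      have := kap_pos hρσ
      positivity
    rw [← Real.sqrt_sq h4, div_pow, mul_pow (lam σ), lam_sq hσ, kap_sq hρσ]
    congr 1
    field_simp
    ring
  have hexp : Real.exp (-(1 / 2 * w)) *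
      (Real.exp (-(x + y - 2 * ρ * w) ^ 2 / (2 * (2 * xi ρ σ * w))) *
        Real.exp (-(x - y - 0) ^ 2 / (2 * (2 * (1 - σ) * w))))
      = Real.exp ((x + y) / 2 * del ρ σ) *
          Real.exp (-((1 + σ) / (2 * xi ρ σ) * w) - Q ρ σ x y / 4 / w) := by
    rw [← Real.exp_add, ← Real.exp_add, ← Real.exp_add, Q, lam_sq hσ, kap_sq hρσ, del]
    congr 1
    field_simp
    rw [show xi ρ σ = 1 - 2 * ρ ^ 2 + σ from rfl]
    ring
  have hpow : w ^ ((n : ℝ) / 2 - 1) = w ^ (((n : ℝ) - 2) / 2 - 1) * w := by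
    rw [← Real.rpow_add_one hw.ne']
    congr 1; ring
  have hhalf : (1 / 2 : ℝ) ^ ((n : ℝ) / 2) = 1 / 2 ^ ((n : ℝ) / 2) := by
    rw [Real.div_rpow zero_le_one zero_le_two, Real.one_rpow]
  have hl := lam_pos hσ
  have hk := kap_pos hρσ
  calc gammaPDFReal (n / 2) (1 / 2) w * condDensity ρ σ w x y
      = (1 / 2 : ℝ) ^ ((n : ℝ) / 2) / Real.Gamma (n / 2) * w ^ ((n : ℝ) / 2 - 1) *
        (2 * (√(2 * Real.pi * (2 * xi ρ σ * w)) * √(2 * Real.pi * (2 * (1 - σ) * w)))⁻¹) *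
        (Real.exp (-(1 / 2 * w)) *
          (Real.exp (-(x + y - 2 * ρ * w) ^ 2 / (2 * (2 * xi ρ σ * w))) *
            Real.exp (-(x - y - 0) ^ 2 / (2 * (2 * (1 - σ) * w))))) := by
        rw [gammaPDFReal, if_pos hw.le, condDensity, gaussianPDFReal, gaussianPDFReal,
          Real.coe_toNNReal _ (by positivity), Real.coe_toNNReal _ (by positivity)]
        ring
    _ = _ := by
        rw [hexp, hs1, hpow, hhalf]
        field_simp
        ring

/-- The Bessel-type formula is the `Γ(n/2, 1/2)`-mixture of the conditional Gaussian densities. -/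
theorem jointDensity_eq_integral (hσ : 0 < 1 - σ ^ 2) (hρσ : 0 < 1 - 2 * ρ ^ 2 + σ) (n : ℕ)
    {x y : ℝ} (h : (x, y) ≠ (0, 0)) :
    IntegrableOn (fun w => gammaPDFReal (n / 2) (1 / 2) w * condDensity ρ σ w x y) (Set.Ioi 0) ∧
    jointDensity ρ σ n x y =
      ∫ w in Set.Ioi (0 : ℝ), gammaPDFReal (n / 2) (1 / 2) w * condDensity ρ σ w x y := by
  have hξ := xi_pos hρσ
  have hs := one_add_sigma_pos hσ
  have hQ := Q_pos hσ hρσ h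
  have hl := lam_pos hσ
  have hk := kap_pos hρσ
  have hα := alp_pos hσ hρσ
  have ha : 0 < (1 + σ) / (2 * xi ρ σ) := by positivity
  have hb : 0 < Q ρ σ x y / 4 := by positivity
  have ha' : (1 + σ) / (2 * xi ρ σ) = (alp ρ σ / (2 * (lam σ * kap ρ σ))) ^ 2 := by
    rw [mul_comm 2 (lam σ * kap ρ σ), ← div_div (alp ρ σ), div_pow, alp_div_lam_mul_kap_sq hσ hρσ]
    field_simp
  constructor
  · refine IntegrableOn.congr_fun ?_ (fun w hw =>
      (gammaPDFReal_mul_condDensity hσ hρσ n hw x y).symm) measurableSet_Ioi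
    exact Integrable.const_mul (integrableOn_rpow_mul_exp_neg_mul_sub_div _ ha hb) _
  · rw [setIntegral_congr_fun measurableSet_Ioi (fun w hw =>
      gammaPDFReal_mul_condDensity hσ hρσ n hw x y), integral_const_mul,
      integral_rpow_mul_exp_neg_mul_sub_div _ ha hb, jointDensity_eq hσ hρσ]
    have h1 : 2 * √((1 + σ) / (2 * xi ρ σ) * (Q ρ σ x y / 4))
        = alp ρ σ * √(Q ρ σ x y) / (2 * (lam σ * kap ρ σ)) := by
      rw [ha', Real.sqrt_mul (by positivity), Real.sqrt_sq (by positivity), Real.sqrt_div hQ.le,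
        show √(4 : ℝ) = 2 by rw [show (4 : ℝ) = 2 ^ 2 by norm_num, Real.sqrt_sq zero_le_two]]
      ring
    have h2 : (Q ρ σ x y / 4 / ((1 + σ) / (2 * xi ρ σ))) ^ (((n : ℝ) - 2) / 2 / 2)
        = (lam σ * kap ρ σ * √(Q ρ σ x y) / alp ρ σ) ^ (((n : ℝ) - 2) / 2) := by
      rw [show Q ρ σ x y / 4 / ((1 + σ) / (2 * xi ρ σ))
          = (lam σ * kap ρ σ * √(Q ρ σ x y) / alp ρ σ) ^ (2 : ℝ) by
        rw [ha', Real.rpow_two]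
        field_simp
        rw [Real.sq_sqrt hQ.le]
        ring, ← Real.rpow_mul (by positivity)]
      congr 1; ring
    rw [h1, h2]
    field_simp

/-! ### The complex Laplace transform of the gamma law -/

theorem integral_gammaMeasure {E : Type*} [NormedAddCommGroup E] [NormedSpace ℝ E] {a r : ℝ}
    (ha : 0 < a) (hr : 0 < r) (f : ℝ → E) :
    ∫ x, f x ∂gammaMeasure a r = ∫ x in Set.Ioi (0 : ℝ), gammaPDFReal a r x • f x := by
  have hm : Measurable (gammaPDF a r) := (measurable_gammaPDFReal a r).ennreal_ofReal
  rw [gammaMeasure, integral_withDensity_eq_integral_toReal_smul hm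
    (Filter.Eventually.of_forall fun x => ENNReal.ofReal_lt_top), ← integral_Ici_eq_integral_Ioi,
    setIntegral_eq_integral_of_forall_compl_eq_zero]
  · simp only [gammaPDF, ENNReal.toReal_ofReal (gammaPDFReal_nonneg ha hr _)]
  · intro x hx
    rw [gammaPDFReal, if_neg (by simpa using hx), zero_smul]

theorem mgf_gammaMeasure {a r t : ℝ} (ha : 0 < a) (hr : 0 < r) (ht : t < r) :
    mgf id (gammaMeasure a r) t = (1 - t / r) ^ (-a) := by
  have hrt : 0 < r - t := sub_pos.2 ht
  rw [mgf, integral_gammaMeasure ha hr]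
  have : ∀ x ∈ Set.Ioi (0 : ℝ), gammaPDFReal a r x • Real.exp (t * id x)
      = r ^ a / Real.Gamma a * (x ^ (a - 1) * Real.exp (-((r - t) * x))) := by
    intro x hx
    rw [gammaPDFReal, if_pos (le_of_lt hx), smul_eq_mul, mul_assoc, ← Real.exp_add, mul_assoc, id]
    ring_nf
  rw [setIntegral_congr_fun measurableSet_Ioi this, integral_const_mul,
    Real.integral_rpow_mul_exp_neg_mul_Ioi ha hrt, one_sub_div hr.ne', Real.rpow_neg (by positivity),
    Real.div_rpow hrt.le hr.le, Real.div_rpow zero_le_one hrt.le, Real.one_rpow]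
  have := (Real.Gamma_pos_of_pos ha).ne'
  have := (Real.rpow_pos_of_pos hrt a).ne'
  have := (Real.rpow_pos_of_pos hr a).ne'
  field_simp

/-- The complex Laplace transform of the gamma law extends the real one by the identity theorem on
the half-plane `re z < r`. -/
theorem complexMGF_gammaMeasure {a r : ℝ} (ha : 0 < a) (hr : 0 < r) {z : ℂ} (hz : z.re < r) :
    complexMGF id (gammaMeasure a r) z = (1 - z / r) ^ (-a : ℂ) := by
  have hsub : ∀ w : ℂ, w.re < r → w.re ∈ interior (integrableExpSet id (gammaMeasure a r)) := by
    intro w hw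
    refine mem_interior.2 ⟨Set.Iio r, fun t (ht : t < r) => ?_, isOpen_Iio, hw⟩
    -- the Bochner integral is nonzero, which it could not be without integrability
    refine Integrable.of_integral_ne_zero ?_
    have h := mgf_gammaMeasure ha hr ht
    rw [mgf] at h
    rw [h]
    have : 0 < 1 - t / r := by rw [one_sub_div hr.ne']; exact div_pos (sub_pos.2 ht) hr
    positivity
  have h1 : AnalyticOnNhd ℂ (complexMGF id (gammaMeasure a r)) {z | z.re < r} := fun w hw =>
    analyticAt_complexMGF (hsub w hw)
  have h2 : AnalyticOnNhd ℂ (fun z : ℂ => (1 - z / r) ^ (-a : ℂ)) {z | z.re < r} := by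
    intro w hw
    refine AnalyticAt.cpow (by fun_prop (disch := exact_mod_cast hr.ne')) analyticAt_const ?_
    left
    rw [Complex.sub_re, Complex.div_ofReal_re, Complex.one_re, sub_pos, div_lt_one hr]
    exact hw
  refine AnalyticOnNhd.eqOn_of_preconnected_of_frequently_eq h1 h2
    (convex_halfSpace_re_lt r).isPreconnected (z₀ := 0) (by simpa using hr) ?_ hz
  have hev : ∀ᶠ x : ℝ in nhdsWithin 0 {0}ᶜ, complexMGF id (gammaMeasure a r) (x : ℂ)
      = (1 - (x : ℂ) / r) ^ (-a : ℂ) := by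
    filter_upwards [nhdsWithin_le_nhds (Iio_mem_nhds hr)] with x hx
    have hx : x < r := hx
    rw [complexMGF_ofReal, mgf_gammaMeasure ha hr hx, Complex.ofReal_cpow]
    · push_cast; rfl
    · rw [one_sub_div hr.ne']; exact (div_pos (sub_pos.2 hx) hr).le
  have hcont : Filter.Tendsto (fun x : ℝ => (x : ℂ)) (nhdsWithin 0 {0}ᶜ) (nhdsWithin 0 {0}ᶜ) := by
    refine tendsto_nhdsWithin_iff.2 ⟨?_, ?_⟩
    · exact (Complex.continuous_ofReal.tendsto' 0 0 Complex.ofReal_zero).mono_left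
        nhdsWithin_le_nhds
    · filter_upwards [self_mem_nhdsWithin] with x hx
      simpa using hx
  exact hcont.frequently hev.frequently

theorem integral_gammaPDFReal_mul_cexp {a r : ℝ} (ha : 0 < a) (hr : 0 < r) {z : ℂ}
    (hz : z.re < r) :
    ∫ w in Set.Ioi (0 : ℝ), (gammaPDFReal a r w : ℂ) * Complex.exp (z * w)
      = (1 - z / r) ^ (-a : ℂ) := by
  rw [← complexMGF_gammaMeasure ha hr hz, complexMGF, integral_gammaMeasure ha hr]
  rfl

/-- The Laplace transform of the square of a standard normal variable, at complex arguments. -/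
theorem integral_cexp_mul_sq_gaussianReal {z : ℂ} (hz : z.re < 1) :
    ∫ c : ℝ, Complex.exp (z * c ^ 2 / 2) ∂gaussianReal 0 1 = (1 - z) ^ (-(1 / 2) : ℂ) := by
  rw [integral_gaussianReal_eq_integral_smul one_ne_zero]
  have hre : 0 < (1 - z).re := by simpa using hz
  have hne : 1 - z ≠ 0 := fun h => by simp [h] at hre
  have h1 : ∀ c : ℝ, gaussianPDFReal 0 1 c • Complex.exp (z * c ^ 2 / 2)
      = ((√(2 * Real.pi))⁻¹ : ℝ) * Complex.exp (-((1 - z) / 2) * (c : ℂ) ^ 2) := by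
    intro c
    rw [gaussianPDFReal, Complex.real_smul, Complex.ofReal_mul, Complex.ofReal_exp, mul_assoc,
      ← Complex.exp_add]
    push_cast
    congr 2
    · simp
    · ring_nf
  simp only [h1]
  rw [integral_const_mul, integral_gaussian_complex (by simpa using hre)]
  have hpi : 0 < 2 * Real.pi := by positivity
  have harg : (1 - z).arg ≠ Real.pi := by
    intro h
    rw [Complex.arg_eq_pi_iff] at h
    linarith [h.1]
  rw [show (Real.pi : ℂ) / ((1 - z) / 2) = ((2 * Real.pi : ℝ) : ℂ) * (1 - z)⁻¹ by
    push_cast; field_simp]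
  -- a positive real factor splits off the principal power
  rw [Complex.cpow_def_of_ne_zero (mul_ne_zero (by exact_mod_cast hpi.ne') (inv_ne_zero hne)),
    Complex.log_ofReal_mul hpi (inv_ne_zero hne), add_mul, Complex.exp_add,
    ← Complex.cpow_def_of_ne_zero (inv_ne_zero hne), Complex.inv_cpow _ _ harg,
    ← Complex.cpow_neg, ← mul_assoc, Complex.ofReal_log hpi.le,
    ← Complex.cpow_def_of_ne_zero (by exact_mod_cast hpi.ne')]
  rw [show ((1 / 2 : ℂ)) = ((1 / 2 : ℝ) : ℂ) by push_cast; rfl, ← Complex.ofReal_cpow hpi.le,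
    ← Real.sqrt_eq_rpow, ← Complex.ofReal_mul, inv_mul_cancel₀ (Real.sqrt_pos.2 hpi).ne']
  simp

/-! ### Characteristic functions on the plane -/

theorem charFunDual_prod_real (μ : Measure (ℝ × ℝ)) (L : StrongDual ℝ (ℝ × ℝ)) :
    charFunDual μ L
      = ∫ p, Complex.exp (Complex.I * ((L (1, 0) * p.1 + L (0, 1) * p.2 : ℝ) : ℂ)) ∂μ := by
  rw [charFunDual_apply]
  congr 1; ext p
  have : L p = L (1, 0) * p.1 + L (0, 1) * p.2 := by
    conv_lhs => rw [show p = p.1 • ((1 : ℝ), (0 : ℝ)) + p.2 • ((0 : ℝ), (1 : ℝ)) by ext <;> simp]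
    rw [map_add, map_smul, map_smul, smul_eq_mul, smul_eq_mul]
    ring
  rw [this, mul_comm]

theorem integral_cexp_gaussianReal_prod (m₁ m₂ : ℝ) (v₁ v₂ : NNReal) (p q : ℝ) :
    ∫ x : ℝ × ℝ, Complex.exp (Complex.I * ((p * x.1 + q * x.2 : ℝ) : ℂ))
        ∂(gaussianReal m₁ v₁).prod (gaussianReal m₂ v₂)
      = Complex.exp (p * m₁ * Complex.I - v₁ * p ^ 2 / 2) *
        Complex.exp (q * m₂ * Complex.I - v₂ * q ^ 2 / 2) := by
  rw [← charFun_gaussianReal, ← charFun_gaussianReal, charFun_apply_real, charFun_apply_real,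
    ← integral_prod_mul]
  congr 1; ext x
  rw [← Complex.exp_add]
  push_cast
  ring_nf

/-! ### One Gaussian vector -/

theorem quadForm_covMat (ρ σ a b c : ℝ) :
    !₂[a, b, c].ofLp ⬝ᵥ (covMat ρ σ).mulVec !₂[a, b, c].ofLp
      = a ^ 2 + b ^ 2 + c ^ 2 + 2 * σ * a * b + 2 * ρ * (a + b) * c := by
  simp [covMat, Matrix.mulVec, dotProduct, Fin.sum_univ_three]
  ring

/-- `1 - ρ ^ 2` and `σ - ρ ^ 2` are the entries of the covariance matrix of `(A, B)` given `C`;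
the form is diagonal in the coordinates `a + b` and `a - b`. -/
theorem condVar_eq (ρ σ a b : ℝ) :
    (1 - ρ ^ 2) * a ^ 2 + (1 - ρ ^ 2) * b ^ 2 + 2 * (σ - ρ ^ 2) * a * b
      = (xi ρ σ * (a + b) ^ 2 + (1 - σ) * (a - b) ^ 2) / 2 := by
  rw [xi]; ring

theorem condVar_nonneg (hσ : 0 < 1 - σ ^ 2) (hρσ : 0 < 1 - 2 * ρ ^ 2 + σ) (a b : ℝ) :
    0 ≤ (1 - ρ ^ 2) * a ^ 2 + (1 - ρ ^ 2) * b ^ 2 + 2 * (σ - ρ ^ 2) * a * b := by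
  have := xi_pos hρσ
  have := one_sub_sigma_pos hσ
  rw [condVar_eq]
  positivity

theorem posSemidef_covMat (hσ : 0 < 1 - σ ^ 2) (hρσ : 0 < 1 - 2 * ρ ^ 2 + σ) :
    (covMat ρ σ).PosSemidef := by
  refine Matrix.PosSemidef.of_dotProduct_mulVec_nonneg ?_ fun x => ?_
  · ext i j
    fin_cases i <;> fin_cases j <;> simp [covMat]
  · have h := quadForm_covMat ρ σ (x 0) (x 1) (x 2)
    have hx : !₂[x 0, x 1, x 2].ofLp = x := by
      ext i; fin_cases i <;> rfl
    rw [hx] at h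
    rw [star_trivial, h]
    -- completing the square in `x 2` leaves the conditional variance
    nlinarith [condVar_nonneg hσ hρσ (x 0) (x 1), sq_nonneg (x 2 + ρ * (x 0 + x 1))]

theorem integral_cexp_multivariateGaussian (hσ : 0 < 1 - σ ^ 2)
    (hρσ : 0 < 1 - 2 * ρ ^ 2 + σ) (a b c : ℝ) :
    ∫ x : EuclideanSpace ℝ (Fin 3), Complex.exp (Complex.I * ((a * x 0 + b * x 1 + c * x 2 : ℝ) : ℂ))
        ∂multivariateGaussian 0 (covMat ρ σ)
      = Complex.exp (-((a ^ 2 + b ^ 2 + c ^ 2 + 2 * σ * a * b + 2 * ρ * (a + b) * c : ℝ) : ℂ) / 2) := by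
  have h := charFun_multivariateGaussian (μ := 0) (posSemidef_covMat hσ hρσ) !₂[a, b, c]
  rw [quadForm_covMat, charFun_apply] at h
  rw [inner_zero_right, Complex.ofReal_zero, zero_mul, zero_sub, ← neg_div] at h
  rw [← h]
  congr 1; ext x
  rw [mul_comm]
  congr 3
  simp [PiLp.inner_apply, Fin.sum_univ_three]

/-- The regression residual of `u A + v B` on `C` is independent of `C`. -/
theorem map_residual_multivariateGaussian (hσ : 0 < 1 - σ ^ 2)
    (hρσ : 0 < 1 - 2 * ρ ^ 2 + σ) (u v : ℝ) :
    (multivariateGaussian 0 (covMat ρ σ)).map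
        (fun x => (u * x 0 + v * x 1 - ρ * (u + v) * x 2, x 2))
      = (gaussianReal 0 ((1 - ρ ^ 2) * u ^ 2 + (1 - ρ ^ 2) * v ^ 2
          + 2 * (σ - ρ ^ 2) * u * v).toNNReal).prod (gaussianReal 0 1) := by
  have hmeas : Measurable (fun x : EuclideanSpace ℝ (Fin 3) =>
    (u * x 0 + v * x 1 - ρ * (u + v) * x 2, x 2)) := by fun_prop
  have : IsProbabilityMeasure ((multivariateGaussian 0 (covMat ρ σ)).map
      (fun x => (u * x 0 + v * x 1 - ρ * (u + v) * x 2, x 2))) :=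
    Measure.isProbabilityMeasure_map hmeas.aemeasurable
  refine Measure.ext_of_charFunDual (funext fun L => ?_)
  rw [charFunDual_prod_real, charFunDual_prod_real, integral_cexp_gaussianReal_prod,
    integral_map hmeas.aemeasurable (by fun_prop)]
  set p := L (1, 0)
  set q := L (0, 1)
  have h := integral_cexp_multivariateGaussian hσ hρσ (p * u) (p * v) (q - p * (ρ * (u + v)))
  rw [← Complex.exp_add, NNReal.coe_one, ← Complex.ofReal_pow,
    Real.coe_toNNReal _ (condVar_nonneg hσ hρσ u v)]
  convert h using 2
  · ext x
    ring_nf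
  · push_cast
    ring

/-- Writing `u A + v B = W + ρ (u + v) C` with `W` independent of `C`, integration over `W` leaves
the Laplace transform of `C ^ 2` at a complex argument. -/
theorem integral_cexp_mul_multivariateGaussian (hσ : 0 < 1 - σ ^ 2)
    (hρσ : 0 < 1 - 2 * ρ ^ 2 + σ) (u v : ℝ) :
    ∫ x : EuclideanSpace ℝ (Fin 3),
        Complex.exp (Complex.I * ((u * (x 0 * x 2) + v * (x 1 * x 2) : ℝ) : ℂ))
        ∂multivariateGaussian 0 (covMat ρ σ)
      = charFn ρ σ 1 u v := by
  set τ := (1 - ρ ^ 2) * u ^ 2 + (1 - ρ ^ 2) * v ^ 2 + 2 * (σ - ρ ^ 2) * u * v with hτ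
  have hτ0 : 0 ≤ τ := condVar_nonneg hσ hρσ u v
  have hmeas : Measurable (fun x : EuclideanSpace ℝ (Fin 3) =>
    (u * x 0 + v * x 1 - ρ * (u + v) * x 2, x 2)) := by fun_prop
  let g : ℝ × ℝ → ℂ := fun q =>
    Complex.exp (Complex.I * (((q.1 + ρ * (u + v) * q.2) * q.2 : ℝ) : ℂ))
  have hg : Continuous g := by fun_prop
  have h1 : ∫ x : EuclideanSpace ℝ (Fin 3),
        Complex.exp (Complex.I * ((u * (x 0 * x 2) + v * (x 1 * x 2) : ℝ) : ℂ))
        ∂multivariateGaussian 0 (covMat ρ σ)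
      = ∫ q, g q ∂(gaussianReal 0 τ.toNNReal).prod (gaussianReal 0 1) := by
    rw [← map_residual_multivariateGaussian hσ hρσ u v, integral_map hmeas.aemeasurable
      hg.aestronglyMeasurable]
    congr 1; ext x
    simp only [g]
    ring_nf
  have hint : Integrable g ((gaussianReal 0 τ.toNNReal).prod (gaussianReal 0 1)) := by
    refine Integrable.of_bound hg.aestronglyMeasurable 1 (Filter.Eventually.of_forall fun q => ?_)
    rw [Complex.norm_exp_I_mul_ofReal]
  have hinner : ∀ c : ℝ, ∫ w : ℝ, g (w, c) ∂gaussianReal 0 τ.toNNReal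
      = Complex.exp ((2 * Complex.I * ρ * (u + v) - τ) * c ^ 2 / 2) := by
    intro c
    have hc := charFun_gaussianReal (μ := 0) (v := τ.toNNReal) c
    rw [charFun_apply_real] at hc
    have : ∀ w : ℝ, g (w, c) = Complex.exp (Complex.I * ρ * (u + v) * c ^ 2) *
        Complex.exp (c * w * Complex.I) := by
      intro w
      rw [← Complex.exp_add]
      simp only [g]
      push_cast
      ring_nf
    simp only [this]
    rw [integral_const_mul, hc, ← Complex.exp_add, Real.coe_toNNReal _ hτ0]
    push_cast
    ring_nf
  rw [h1, integral_prod_symm _ hint]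
  simp only [hinner]
  rw [integral_cexp_mul_sq_gaussianReal, charFn]
  · congr 1
    · rw [hτ]; push_cast; ring
    · push_cast; ring
  · simp
    linarith

/-! ### Fourier transform of the conditional density -/

theorem map_add_sub_volume :
    (volume : Measure (ℝ × ℝ)).map (fun p => (p.1 + p.2, p.1 - p.2))
      = ENNReal.ofReal (1 / 2) • volume := by
  let b := Module.Basis.finTwoProd ℝ
  have hdet : LinearMap.det (Matrix.toLin b b !![1, 1; 1, -1]) = -2 := by
    rw [LinearMap.det_toLin, Matrix.det_fin_two_of]; norm_num
  have h := Measure.map_linearMap_addHaar_eq_smul_addHaar (volume : Measure (ℝ × ℝ))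
    (f := Matrix.toLin b b !![1, 1; 1, -1]) (by rw [hdet]; norm_num)
  have hfun : (fun p : ℝ × ℝ => (p.1 + p.2, p.1 - p.2))
      = Matrix.toLin b b !![1, 1; 1, -1] := by
    ext p <;> simp [b, Matrix.toLin_finTwoProd_apply, sub_eq_add_neg]
  rw [hfun, h, hdet]
  norm_num

/-- The half-sum and half-difference of independent normal variables have density
`condDensity`. -/
theorem map_gaussianReal_prod_eq_withDensity (hσ : 0 < 1 - σ ^ 2)
    (hρσ : 0 < 1 - 2 * ρ ^ 2 + σ) {w : ℝ} (hw : 0 < w) :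
    ((gaussianReal (2 * ρ * w) (2 * xi ρ σ * w).toNNReal).prod
        (gaussianReal 0 (2 * (1 - σ) * w).toNNReal)).map
        (fun q => ((q.1 + q.2) / 2, (q.1 - q.2) / 2))
      = volume.withDensity (fun p : ℝ × ℝ => ENNReal.ofReal (condDensity ρ σ w p.1 p.2)) := by
  have hξ := xi_pos hρσ
  have hs := one_sub_sigma_pos hσ
  have hv1 : (2 * xi ρ σ * w).toNNReal ≠ 0 := (Real.toNNReal_pos.2 (by positivity)).ne'
  have hv2 : (2 * (1 - σ) * w).toNNReal ≠ 0 := (Real.toNNReal_pos.2 (by positivity)).ne'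
  have hT : Measurable (fun q : ℝ × ℝ => ((q.1 + q.2) / 2, (q.1 - q.2) / 2)) := by fun_prop
  have hS : Measurable (fun p : ℝ × ℝ => (p.1 + p.2, p.1 - p.2)) := by fun_prop
  have hc : Measurable (fun p : ℝ × ℝ => ENNReal.ofReal (condDensity ρ σ w p.1 p.2)) :=
    ((measurable_condDensity ρ σ).comp (measurable_const.prodMk measurable_id)).ennreal_ofReal
  rw [gaussianReal_of_var_ne_zero _ hv1, gaussianReal_of_var_ne_zero _ hv2,
    prod_withDensity (measurable_gaussianPDF _ _) (measurable_gaussianPDF _ _),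
    ← Measure.volume_eq_prod]
  set f := gaussianPDF (2 * ρ * w) (2 * xi ρ σ * w).toNNReal with hf
  set g := gaussianPDF 0 (2 * (1 - σ) * w).toNNReal with hg
  have hfm : Measurable f := measurable_gaussianPDF _ _
  have hgm : Measurable g := measurable_gaussianPDF _ _
  refine Measure.ext_of_lintegral _ fun φ hφ => ?_
  rw [lintegral_map hφ hT, lintegral_withDensity_eq_lintegral_mul _ (by fun_prop) (by fun_prop),
    lintegral_withDensity_eq_lintegral_mul _ hc hφ]
  have hcond : ∀ p : ℝ × ℝ, ENNReal.ofReal (condDensity ρ σ w p.1 p.2) * φ p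
      = 2 * (f (p.1 + p.2) * g (p.1 - p.2) *
          φ ((p.1 + p.2 + (p.1 - p.2)) / 2, (p.1 + p.2 - (p.1 - p.2)) / 2)) := by
    intro p
    have hp : ((p.1 + p.2 + (p.1 - p.2)) / 2, (p.1 + p.2 - (p.1 - p.2)) / 2) = p := by
      ext <;> simp only <;> ring
    rw [hp, condDensity, mul_assoc 2, ENNReal.ofReal_mul zero_le_two,
      ENNReal.ofReal_mul (gaussianPDFReal_nonneg _ _ _), ENNReal.ofReal_ofNat]
    simp only [hf, hg, gaussianPDF]
    ring
  simp only [Pi.mul_apply, hcond]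
  have hF : Measurable (fun q : ℝ × ℝ => f q.1 * g q.2 * φ ((q.1 + q.2) / 2, (q.1 - q.2) / 2)) :=
    by fun_prop
  rw [lintegral_const_mul _ (by fun_prop)]
  have key := lintegral_map (μ := volume) hF hS
  rw [map_add_sub_volume, lintegral_smul_measure] at key
  rw [← key, smul_eq_mul, ← mul_assoc, ← ENNReal.ofReal_ofNat, ← ENNReal.ofReal_mul zero_le_two]
  norm_num

theorem integrable_condDensity (hσ : 0 < 1 - σ ^ 2) (hρσ : 0 < 1 - 2 * ρ ^ 2 + σ) {w : ℝ}
    (hw : 0 < w) :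
    Integrable (fun p : ℝ × ℝ => condDensity ρ σ w p.1 p.2) ∧
      ∫ p : ℝ × ℝ, condDensity ρ σ w p.1 p.2 = 1 := by
  have hc : Measurable (fun p : ℝ × ℝ => condDensity ρ σ w p.1 p.2) :=
    (measurable_condDensity ρ σ).comp (measurable_const.prodMk measurable_id)
  -- the density belongs to a push-forward of a probability measure
  have hl : ∫⁻ p : ℝ × ℝ, ENNReal.ofReal (condDensity ρ σ w p.1 p.2) = 1 := by
    rw [← setLIntegral_univ, ← withDensity_apply _ MeasurableSet.univ,
      ← map_gaussianReal_prod_eq_withDensity hσ hρσ hw,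
      Measure.map_apply (by fun_prop) MeasurableSet.univ, Set.preimage_univ, measure_univ]
  have hnn : 0 ≤ᵐ[volume] fun p : ℝ × ℝ => condDensity ρ σ w p.1 p.2 :=
    Filter.Eventually.of_forall fun p => condDensity_nonneg _ _ _ _ _
  constructor
  · refine ⟨hc.aestronglyMeasurable, ?_⟩
    rw [hasFiniteIntegral_iff_ofReal hnn, hl]
    exact ENNReal.one_lt_top
  · rw [integral_eq_lintegral_of_nonneg_ae hnn hc.aestronglyMeasurable, hl, ENNReal.toReal_one]

theorem integral_condDensity_mul_cexp (hσ : 0 < 1 - σ ^ 2) (hρσ : 0 < 1 - 2 * ρ ^ 2 + σ) {w : ℝ}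
    (hw : 0 < w) (u v : ℝ) :
    ∫ p : ℝ × ℝ, (condDensity ρ σ w p.1 p.2 : ℂ) *
        Complex.exp (Complex.I * ((u * p.1 + v * p.2 : ℝ) : ℂ))
      = Complex.exp ((Complex.I * ρ * (u + v) - ((1 - ρ ^ 2) * u ^ 2 + (1 - ρ ^ 2) * v ^ 2
          + 2 * (σ - ρ ^ 2) * u * v : ℝ) / 2) * w) := by
  have hξ := xi_pos hρσ
  have hs := one_sub_sigma_pos hσ
  have hc : Measurable (fun p : ℝ × ℝ => ENNReal.ofReal (condDensity ρ σ w p.1 p.2)) :=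
    ((measurable_condDensity ρ σ).comp (measurable_const.prodMk measurable_id)).ennreal_ofReal
  have h := integral_withDensity_eq_integral_toReal_smul (μ := volume) hc
    (Filter.Eventually.of_forall fun p => ENNReal.ofReal_lt_top)
    (fun p : ℝ × ℝ => Complex.exp (Complex.I * ((u * p.1 + v * p.2 : ℝ) : ℂ)))
  simp only [ENNReal.toReal_ofReal (condDensity_nonneg _ _ _ _ _), Complex.real_smul] at h
  rw [← h, ← map_gaussianReal_prod_eq_withDensity hσ hρσ hw,
    integral_map (by fun_prop) (by fun_prop)]
  have h2 := integral_cexp_gaussianReal_prod (2 * ρ * w) 0 (2 * xi ρ σ * w).toNNReal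
    (2 * (1 - σ) * w).toNNReal ((u + v) / 2) ((u - v) / 2)
  rw [← Complex.exp_add, Real.coe_toNNReal _ (by positivity), Real.coe_toNNReal _ (by positivity)]
    at h2
  rw [condVar_eq]
  convert h2 using 2
  · ext x
    ring_nf
  · push_cast
    ring

/-! ### The Fourier transform of the joint density -/

theorem integrable_gammaPDFReal {a r : ℝ} (ha : 0 < a) (hr : 0 < r) :
    Integrable (gammaPDFReal a r) := by
  refine ⟨(measurable_gammaPDFReal a r).aestronglyMeasurable, ?_⟩
  rw [hasFiniteIntegral_iff_ofReal
    (Filter.Eventually.of_forall fun x => gammaPDFReal_nonneg ha hr x)]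
  exact (lintegral_gammaPDF_eq_one ha hr).trans_lt ENNReal.one_lt_top

theorem integrable_gammaPDFReal_mul_condDensity (hσ : 0 < 1 - σ ^ 2)
    (hρσ : 0 < 1 - 2 * ρ ^ 2 + σ) {n : ℕ} (hn : 1 ≤ n) :
    Integrable (fun q : ℝ × ℝ × ℝ =>
        gammaPDFReal (n / 2) (1 / 2) q.1 * condDensity ρ σ q.1 q.2.1 q.2.2)
      ((volume.restrict (Set.Ioi 0)).prod volume) := by
  have hn2 : (0 : ℝ) < n / 2 := by
    have : (0 : ℝ) < n := by exact_mod_cast hn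
    positivity
  have hm : Measurable (fun q : ℝ × ℝ × ℝ =>
      gammaPDFReal (n / 2) (1 / 2) q.1 * condDensity ρ σ q.1 q.2.1 q.2.2) :=
    ((measurable_gammaPDFReal _ _).comp measurable_fst).mul (measurable_condDensity ρ σ)
  rw [integrable_prod_iff hm.aestronglyMeasurable]
  constructor
  · refine (ae_restrict_iff' measurableSet_Ioi).2 (Filter.Eventually.of_forall fun w hw => ?_)
    exact (integrable_condDensity hσ hρσ hw).1.const_mul (gammaPDFReal (n / 2) (1 / 2) w)
  · refine IntegrableOn.congr_fun (f := gammaPDFReal (n / 2) (1 / 2))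
      (integrable_gammaPDFReal hn2 (by norm_num)).integrableOn (fun w hw => ?_) measurableSet_Ioi
    have hg := gammaPDFReal_nonneg hn2 (show (0 : ℝ) < 1 / 2 by norm_num) w
    simp only [Real.norm_of_nonneg (mul_nonneg hg (condDensity_nonneg _ _ _ _ _))]
    rw [integral_const_mul, (integrable_condDensity hσ hρσ hw).2, mul_one]

/-- The mixture formula may fail at the origin, where the Bessel integral diverges and
its value is `0` by convention. -/
theorem ae_jointDensity_eq_integral (hσ : 0 < 1 - σ ^ 2) (hρσ : 0 < 1 - 2 * ρ ^ 2 + σ) (n : ℕ) :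
    ∀ᵐ p : ℝ × ℝ, jointDensity ρ σ n p.1 p.2 =
      ∫ w in Set.Ioi (0 : ℝ), gammaPDFReal (n / 2) (1 / 2) w * condDensity ρ σ w p.1 p.2 := by
  filter_upwards [compl_mem_ae_iff.2 (measure_singleton ((0 : ℝ), (0 : ℝ)))] with p hp
  exact (jointDensity_eq_integral hσ hρσ n hp).2

theorem integrable_jointDensity (hσ : 0 < 1 - σ ^ 2) (hρσ : 0 < 1 - 2 * ρ ^ 2 + σ) {n : ℕ}
    (hn : 1 ≤ n) : Integrable (fun p : ℝ × ℝ => jointDensity ρ σ n p.1 p.2) :=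
  (integrable_gammaPDFReal_mul_condDensity hσ hρσ hn).integral_prod_right.congr
    ((ae_jointDensity_eq_integral hσ hρσ n).mono fun _ h => h.symm)

theorem integral_jointDensity_mul_cexp (hσ : 0 < 1 - σ ^ 2) (hρσ : 0 < 1 - 2 * ρ ^ 2 + σ) {n : ℕ}
    (hn : 1 ≤ n) (u v : ℝ) :
    ∫ p : ℝ × ℝ, (jointDensity ρ σ n p.1 p.2 : ℂ) *
        Complex.exp (Complex.I * ((u * p.1 + v * p.2 : ℝ) : ℂ))
      = charFn ρ σ n u v := by
  have hn2 : (0 : ℝ) < n / 2 := by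
    have : (0 : ℝ) < n := by exact_mod_cast hn
    positivity
  have hint : Integrable (fun q : (ℝ × ℝ) × ℝ =>
      ((gammaPDFReal (n / 2) (1 / 2) q.2 * condDensity ρ σ q.2 q.1.1 q.1.2 : ℝ) : ℂ) *
        Complex.exp (Complex.I * ((u * q.1.1 + v * q.1.2 : ℝ) : ℂ)))
      (volume.prod (volume.restrict (Set.Ioi 0))) := by
    refine ((integrable_gammaPDFReal_mul_condDensity hσ hρσ hn).swap.ofReal (𝕜 := ℂ)).mul_bdd
      (c := 1) (by fun_prop) (Filter.Eventually.of_forall fun q => ?_)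
    rw [Complex.norm_exp_I_mul_ofReal]
  calc ∫ p : ℝ × ℝ, (jointDensity ρ σ n p.1 p.2 : ℂ) *
        Complex.exp (Complex.I * ((u * p.1 + v * p.2 : ℝ) : ℂ))
      = ∫ p : ℝ × ℝ, ∫ w in Set.Ioi (0 : ℝ),
          ((gammaPDFReal (n / 2) (1 / 2) w * condDensity ρ σ w p.1 p.2 : ℝ) : ℂ) *
            Complex.exp (Complex.I * ((u * p.1 + v * p.2 : ℝ) : ℂ)) := by
        refine integral_congr_ae ((ae_jointDensity_eq_integral hσ hρσ n).mono fun p hp => ?_)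
        simp only
        rw [integral_mul_const, hp, integral_complex_ofReal]
    _ = ∫ w in Set.Ioi (0 : ℝ), ∫ p : ℝ × ℝ,
          ((gammaPDFReal (n / 2) (1 / 2) w * condDensity ρ σ w p.1 p.2 : ℝ) : ℂ) *
            Complex.exp (Complex.I * ((u * p.1 + v * p.2 : ℝ) : ℂ)) :=
        integral_integral_swap hint
    _ = ∫ w in Set.Ioi (0 : ℝ), (gammaPDFReal (n / 2) (1 / 2) w : ℂ) *
          Complex.exp ((Complex.I * ρ * (u + v) - ((1 - ρ ^ 2) * u ^ 2 + (1 - ρ ^ 2) * v ^ 2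
          + 2 * (σ - ρ ^ 2) * u * v : ℝ) / 2) * w) := by
        refine setIntegral_congr_fun measurableSet_Ioi fun w hw => ?_
        rw [← integral_condDensity_mul_cexp hσ hρσ hw, ← integral_const_mul]
        simp only [Complex.ofReal_mul, mul_assoc]
    _ = charFn ρ σ n u v := by
        rw [integral_gammaPDFReal_mul_cexp hn2 (by norm_num), charFn]
        · congr 1
          · push_cast; ring
          · push_cast; ring
        · have := condVar_nonneg hσ hρσ u v
          rw [Complex.sub_re, ← Complex.ofReal_ofNat, Complex.div_ofReal_re, Complex.ofReal_re]
          simp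
          linarith

/-! ### The law of the pair of sums -/

theorem integral_cexp_sum_mul (hσ : 0 < 1 - σ ^ 2) (hρσ : 0 < 1 - 2 * ρ ^ 2 + σ)
    {n : ℕ} {Ω : Type*} [MeasurableSpace Ω] {P : Measure Ω}
    {A B C : Fin n → Ω → ℝ}
    (hindep : iIndepFun (fun j ω => !₂[A j ω, B j ω, C j ω]) P)
    (hlaw : ∀ j, HasLaw (fun ω => !₂[A j ω, B j ω, C j ω])
      (multivariateGaussian 0 (covMat ρ σ)) P) (u v : ℝ) :
    ∫ ω, Complex.exp (Complex.I *
        ((u * ∑ j, A j ω * C j ω + v * ∑ j, B j ω * C j ω : ℝ) : ℂ)) ∂P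
      = charFn ρ σ n u v := by
  let g : EuclideanSpace ℝ (Fin 3) → ℂ := fun x =>
    Complex.exp (Complex.I * ((u * (x 0 * x 2) + v * (x 1 * x 2) : ℝ) : ℂ))
  have hg : Continuous g := by fun_prop
  have h1 : ∀ ω, Complex.exp (Complex.I *
        ((u * ∑ j, A j ω * C j ω + v * ∑ j, B j ω * C j ω : ℝ) : ℂ))
      = ∏ j, g !₂[A j ω, B j ω, C j ω] := by
    intro ω
    rw [← Complex.exp_sum, ← Finset.mul_sum, ← Complex.ofReal_sum, Finset.sum_add_distrib,
      ← Finset.mul_sum, ← Finset.mul_sum]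
    rfl
  simp only [h1]
  rw [hindep.integral_fun_prod_comp (f := fun _ => g) (fun j => (hlaw j).aemeasurable)
    (fun j => hg.aestronglyMeasurable)]
  have h2 : ∀ j, ∫ ω, g !₂[A j ω, B j ω, C j ω] ∂P = charFn ρ σ 1 u v := fun j =>
    ((hlaw j).integral_comp hg.aestronglyMeasurable).trans
      (integral_cexp_mul_multivariateGaussian hσ hρσ u v)
  simp only [h2]
  rw [Finset.prod_const, Finset.card_univ, Fintype.card_fin, charFn, charFn, ← Complex.cpow_nat_mul]
  congr 1
  push_cast
  ring

theorem hasLaw_sum_mul (hσ : 0 < 1 - σ ^ 2) (hρσ : 0 < 1 - 2 * ρ ^ 2 + σ)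
    {n : ℕ} (hn : 1 ≤ n) {Ω : Type*} [MeasurableSpace Ω] {P : Measure Ω} [IsProbabilityMeasure P]
    {A B C : Fin n → Ω → ℝ}
    (hindep : iIndepFun (fun j ω => !₂[A j ω, B j ω, C j ω]) P)
    (hlaw : ∀ j, HasLaw (fun ω => !₂[A j ω, B j ω, C j ω])
      (multivariateGaussian 0 (covMat ρ σ)) P) :
    HasLaw (fun ω => (∑ j, A j ω * C j ω, ∑ j, B j ω * C j ω))
      ((volume : Measure (ℝ × ℝ)).withDensity
        (fun p => ENNReal.ofReal (jointDensity ρ σ n p.1 p.2))) P := by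
  have hcoord : ∀ (j : Fin n) (i : Fin 3),
      AEMeasurable (fun ω => !₂[A j ω, B j ω, C j ω] i) P := fun j i =>
    (by fun_prop : Measurable fun x : EuclideanSpace ℝ (Fin 3) => x i).comp_aemeasurable
      (hlaw j).aemeasurable
  have hA : ∀ j, AEMeasurable (A j) P := fun j => hcoord j 0
  have hB : ∀ j, AEMeasurable (B j) P := fun j => hcoord j 1
  have hC : ∀ j, AEMeasurable (C j) P := fun j => hcoord j 2
  have hXY : AEMeasurable (fun ω => (∑ j, A j ω * C j ω, ∑ j, B j ω * C j ω)) P := by fun_prop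
  refine ⟨hXY, ?_⟩
  -- finiteness suffices for uniqueness; total mass one is then part of the conclusion
  have hfin := isFiniteMeasure_withDensity_ofReal (integrable_jointDensity hσ hρσ hn).2
  have := Measure.isProbabilityMeasure_map hXY
  refine Measure.ext_of_charFunDual (funext fun L => ?_)
  rw [charFunDual_prod_real, charFunDual_prod_real, integral_map hXY (by fun_prop),
    integral_cexp_sum_mul hσ hρσ hindep hlaw,
    integral_withDensity_eq_integral_toReal_smul (measurable_jointDensity ρ σ n).ennreal_ofReal
      (Filter.Eventually.of_forall fun p => ENNReal.ofReal_lt_top),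
    ← integral_jointDensity_mul_cexp hσ hρσ hn]
  simp only [ENNReal.toReal_ofReal (jointDensity_nonneg hσ hρσ n _ _), Complex.real_smul]

end TrivariateNormal

theorem mainTheorem1 {ρ σ : ℝ} (hσ : 0 < 1 - σ ^ 2) (hρσ : 0 < 1 - 2 * ρ ^ 2 + σ)
    {n : ℕ} (hn : 1 ≤ n)
    {Ω : Type*} [MeasurableSpace Ω] (P : Measure Ω) [IsProbabilityMeasure P]
    (A B C : Fin n → Ω → ℝ)
    (hindep : iIndepFun (fun j ω => !₂[A j ω, B j ω, C j ω]) P)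
    (hlaw : ∀ j, HasLaw (fun ω => !₂[A j ω, B j ω, C j ω])
      (multivariateGaussian 0 (TrivariateNormal.covMat ρ σ)) P) :
    -- the characteristic function of the pair of sample covariances
    (∀ u v : ℝ,
      ∫ ω, Complex.exp (Complex.I *
          ((u * ∑ j, A j ω * C j ω + v * ∑ j, B j ω * C j ω : ℝ) : ℂ)) ∂P
        = TrivariateNormal.charFn ρ σ n u v) ∧
    -- `f_n` is a nonnegative measurable function and is the joint density of the pair
    Measurable (fun p : ℝ × ℝ => TrivariateNormal.jointDensity ρ σ n p.1 p.2) ∧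
    (∀ x y : ℝ, 0 ≤ TrivariateNormal.jointDensity ρ σ n x y) ∧
    HasLaw (fun ω => (∑ j, A j ω * C j ω, ∑ j, B j ω * C j ω))
      ((volume : Measure (ℝ × ℝ)).withDensity
        (fun p => ENNReal.ofReal (TrivariateNormal.jointDensity ρ σ n p.1 p.2))) P ∧
    -- the special cases of sample size `1, 2, 3, 4`, away from the origin
    (∀ x y : ℝ, (x, y) ≠ (0, 0) →
      (TrivariateNormal.jointDensity ρ σ 1 x y =
          1 / (2 * Real.pi) *
            (Real.exp (1 / TrivariateNormal.xi ρ σ * (ρ * x + ρ * y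
                - Real.sqrt (TrivariateNormal.eta σ) * Real.sqrt (TrivariateNormal.R ρ σ x y)))
              / Real.sqrt (TrivariateNormal.R ρ σ x y))) ∧
      (TrivariateNormal.jointDensity ρ σ 2 x y =
          TrivariateNormal.lam σ * TrivariateNormal.kap ρ σ / (2 * Real.pi) *
            Real.exp ((x + y) / 2 * TrivariateNormal.del ρ σ) *
            TrivariateNormal.besselK 0
              (TrivariateNormal.alp ρ σ /
                  (2 * TrivariateNormal.lam σ * TrivariateNormal.kap ρ σ) *
                Real.sqrt (TrivariateNormal.Q ρ σ x y))) ∧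
      (TrivariateNormal.jointDensity ρ σ 3 x y =
          1 / (2 * Real.pi * Real.sqrt (1 - σ ^ 2)) *
            Real.exp (1 / TrivariateNormal.xi ρ σ * (ρ * x + ρ * y
                - Real.sqrt (TrivariateNormal.eta σ) *
                  Real.sqrt (TrivariateNormal.R ρ σ x y)))) ∧
      (TrivariateNormal.jointDensity ρ σ 4 x y =
          TrivariateNormal.lam σ ^ 2 * TrivariateNormal.kap ρ σ ^ 2 /
              (4 * Real.pi * TrivariateNormal.alp ρ σ) *
            Real.exp ((x + y) / 2 * TrivariateNormal.del ρ σ) *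
            Real.sqrt (TrivariateNormal.Q ρ σ x y) *
            TrivariateNormal.besselK 1
              (TrivariateNormal.alp ρ σ /
                  (2 * TrivariateNormal.lam σ * TrivariateNormal.kap ρ σ) *
                Real.sqrt (TrivariateNormal.Q ρ σ x y)))) := by
  open TrivariateNormal in
  exact ⟨integral_cexp_sum_mul hσ hρσ hindep hlaw, measurable_jointDensity ρ σ n,
    jointDensity_nonneg hσ hρσ n, hasLaw_sum_mul hσ hρσ hn hindep hlaw, fun x y h =>
      ⟨jointDensity_one hσ hρσ h, jointDensity_two hσ hρσ x y, jointDensity_three hσ hρσ h,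
        jointDensity_four hσ hρσ x y⟩⟩
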